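/- Let $\mathcal H=\bigotimes_{a=1}^n\mathcal H_a$ with $\dim\mathcal H_a=d_a<\infty$, and fix neighborhoods $\mathcal N_1,\dots,\mathcal N_K\subsetneq\{1,\dots,n\}$, $K\ge 1$. A \emph{neighborhood map} is a completely positive trace-preserving map on $\mathcal B(\mathcal H)$ of the form $\mathcal E_{\mathcal N_j}\otimes\mathcal I_{\overline{\mathcal N}_j}$ for some $j$, where $\mathcal E_{\mathcal N_j}$ is a completely positive trace-preserving map on the operators of the subsystems in $\mathcal N_j$ and $\mathcal I_{\overline{\mathcal N}_j}$ is the identity map on the operators of the remaining subsystems. A state $\rho$ is \emph{discrete-time quasi-locally stabilizable} if there is a sequence $(\mathcal E_t)_{t\ge 0}$ of neighborhood maps such that, with $\mathcal E_{t,s}=\mathcal E_{t-1}\circ\cdots\circ\mathcal E_s$ and $\mathcal E_{s,s}=\mathcal I$, one has $\mathcal E_{t,s}(\rho)=\rho$ for all $t\ge s\ge 0$, and $\lim_{t\to\infty}\|\mathcal E_{t,s}(\sigma)-\rho\|_1=0$ for every density operator $\sigma$ on $\mathcal H$ and every $s\ge 0$. A \emph{quasi-local Hamiltonian} is a sum $H=\sum_{k=1}^K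 H_k$ with $H_k=H_{\mathcal N_k}\otimes I_{\overline{\mathcal N}_k}$ Hermitian. A \emph{ground state} of a Hermitian operator $A$ is a unit vector that minimizes $\langle\varphi|A|\varphi\rangle$ among all unit vectors $|\varphi\rangle\in\mathcal H$. $H=\sum_k H_k$ is \emph{frustration-free} if every ground state of $H$ is a ground state of every $H_k$, and it is a \emph{parent Hamiltonian} for $|\psi\rangle$ if $|\psi\rangle$ is a ground state of $H$. Let $|\psi\rangle\in\mathcal H$ be a unit vector. Then the pure state $\rho=|\psi\rangle\langle\psi|$ is discrete-time quasi-locally stabilizable if and only if there is a frustration-free quasi-local parent Hamiltonian $H=\sum_k H_k$ for $|\psi\rangle$ of which $|\psi\rangle$ is, up to a phase, the unique ground state. -/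

import Mathlib

open Filter Topology
open scoped Matrix Kronecker ComplexOrder

namespace QuasiLocal

/-! ### Quantum states, channels and tensor products with the identity -/

/-- Linear maps on the operators of a finite-dimensional Hilbert space with orthonormal basis
labelled by `ι` (operators are given by their matrices in that basis). -/
abbrev SuperOp (ι : Type) : Type := Matrix ι ι ℂ →ₗ[ℂ] Matrix ι ι ℂ

/-- Density matrices: positive semidefinite, of trace one. -/
def IsDensity {ι : Type} [Fintype ι] (σ : Matrix ι ι ℂ) : Prop :=
  σ.PosSemidef ∧ σ.trace = 1

/-- The map `E ⊗ id` on the operators of `ℂ^ι ⊗ ℂ^κ`: writing `X` as a block matrix with blocks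
`X_{b b'}` (matrices over `ι`), the blocks of `(E ⊗ id) X` are `E (X_{b b'})`.
It is the linear map with `(E ⊗ id) (A ⊗ B) = E A ⊗ B`. -/
def tensorId {ι : Type} (κ : Type) (E : SuperOp ι) : SuperOp (ι × κ) where
  toFun X := Matrix.of fun p q => E (X.submatrix (fun a => (a, p.2)) (fun a => (a, q.2))) p.1 q.1
  map_add' X Y := by
    ext p q
    simp [Matrix.submatrix_add]
  map_smul' c X := by
    ext p q
    simp [Matrix.submatrix_smul]

/-- Completely positive, trace-preserving maps: `E ⊗ id` preserves positive semidefiniteness for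
ancillas `ℂ^m` of every finite dimension `m`, and `E` preserves the trace. -/
def IsCPTP {ι : Type} [Fintype ι] (E : SuperOp ι) : Prop :=
  (∀ (m : ℕ) (X : Matrix (ι × Fin m) (ι × Fin m) ℂ),
      X.PosSemidef → (tensorId (Fin m) E X).PosSemidef) ∧
    ∀ X : Matrix ι ι ℂ, (E X).trace = X.trace

/-! ### Multipartite systems, neighborhood operators and neighborhood maps -/

/-- Labels of the product basis of `⨂ a, ℂ^(d a)`. -/
abbrev Config {n : ℕ} (d : Fin n → ℕ) : Type := (a : Fin n) → Fin (d a)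

/-- Labels of the product basis of the factor `⨂ a ∈ S, ℂ^(d a)`. -/
abbrev InConfig {n : ℕ} (d : Fin n → ℕ) (S : Finset (Fin n)) : Type :=
  (a : {a : Fin n // a ∈ S}) → Fin (d a)

/-- Labels of the product basis of the factor `⨂ a ∉ S, ℂ^(d a)`. -/
abbrev OutConfig {n : ℕ} (d : Fin n → ℕ) (S : Finset (Fin n)) : Type :=
  (a : {a : Fin n // a ∉ S}) → Fin (d a)

/-- The identification of `⨂ a, ℂ^(d a)` with `(⨂ a ∈ S, ℂ^(d a)) ⊗ (⨂ a ∉ S, ℂ^(d a))`, on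
product basis labels. -/
def splitConfig {n : ℕ} (d : Fin n → ℕ) (S : Finset (Fin n)) :
    Config d ≃ InConfig d S × OutConfig d S :=
  Equiv.piEquivPiSubtypeProd (fun a => a ∈ S) (fun a => Fin (d a))

/-- The operator `M ⊗ 1` on the whole system, with `M` acting on the subsystems in `S`. -/
def extendOp {n : ℕ} {d : Fin n → ℕ} (S : Finset (Fin n))
    (M : Matrix (InConfig d S) (InConfig d S) ℂ) : Matrix (Config d) (Config d) ℂ :=
  Matrix.reindex (splitConfig d S).symm (splitConfig d S).symm
    (M ⊗ₖ (1 : Matrix (OutConfig d S) (OutConfig d S) ℂ))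

/-- The map `F ⊗ id` on the operators of the whole system, with `F` acting on the operators of
the subsystems in `S`. -/
def extendMap {n : ℕ} {d : Fin n → ℕ} (S : Finset (Fin n))
    (F : SuperOp (InConfig d S)) : SuperOp (Config d) :=
  (Matrix.reindexLinearEquiv ℂ ℂ (splitConfig d S).symm (splitConfig d S).symm).toLinearMap ∘ₗ
    tensorId (OutConfig d S) F ∘ₗ
      (Matrix.reindexLinearEquiv ℂ ℂ (splitConfig d S) (splitConfig d S)).toLinearMap

/-- CPTP neighborhood maps relative to the family of neighborhoods `N`: for some `j`, the map is
`F ⊗ id` with `F` a CPTP map on the subsystems in `N j`. -/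
def IsNeighborhoodMap {n K : ℕ} {d : Fin n → ℕ} (N : Fin K → Finset (Fin n))
    (E : SuperOp (Config d)) : Prop :=
  ∃ (j : Fin K) (F : SuperOp (InConfig d (N j))), IsCPTP F ∧ E = extendMap (N j) F

/-! ### Discrete-time quasi-local stabilizability -/

/-- `propagator E s k` is the propagator `E_{s+k,s} = E_{s+k-1} ∘ ⋯ ∘ E_s` from time `s` to time
`s + k`. -/
def propagator {ι : Type} (E : ℕ → SuperOp ι) (s : ℕ) : ℕ → SuperOp ι
  | 0 => LinearMap.id
  | k + 1 => E (s + k) ∘ₗ propagator E s k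

/-- Discrete-time quasi-local stabilizability of `ρ`: for some sequence of neighborhood maps, `ρ`
is invariant and attracts every initial state from every initial time. -/
def IsQLS {n K : ℕ} {d : Fin n → ℕ} (N : Fin K → Finset (Fin n))
    (ρ : Matrix (Config d) (Config d) ℂ) : Prop :=
  ∃ E : ℕ → SuperOp (Config d),
    (∀ t, IsNeighborhoodMap N (E t)) ∧
    (∀ s k, propagator E s k ρ = ρ) ∧
    ∀ σ, IsDensity σ → ∀ s, Tendsto (fun k => propagator E s k σ) atTop (𝓝 ρ)

/-! ### Pure states and frustration-free quasi-local parent Hamiltonians -/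

/-- Unit vectors: `⟨ψ|ψ⟩ = 1`. -/
def IsUnitVec {ι : Type} [Fintype ι] (ψ : ι → ℂ) : Prop := star ψ ⬝ᵥ ψ = 1

/-- The operator `|ψ⟩⟨ψ|`. -/
def pureState {ι : Type} (ψ : ι → ℂ) : Matrix ι ι ℂ := Matrix.vecMulVec ψ (star ψ)

/-- The energy `⟨ψ|H|ψ⟩` (which is real for Hermitian `H`). -/
def energy {ι : Type} [Fintype ι] (H : Matrix ι ι ℂ) (ψ : ι → ℂ) : ℝ :=
  (star ψ ⬝ᵥ (H *ᵥ ψ)).re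

/-- The ground states of `H`: the minimizers of the energy among unit vectors. -/
def groundStates {ι : Type} [Fintype ι] (H : Matrix ι ι ℂ) : Set (ι → ℂ) :=
  {ψ | IsUnitVec ψ ∧ ∀ φ, IsUnitVec φ → energy H ψ ≤ energy H φ}

/-- `h` lists the terms of a quasi-local Hamiltonian `∑ k, h k`: each `h k` is Hermitian and of
the form `M ⊗ 1` with `M` acting on the subsystems in `N k`. -/
def IsQuasiLocalHamiltonian {n K : ℕ} {d : Fin n → ℕ} (N : Fin K → Finset (Fin n))
    (h : Fin K → Matrix (Config d) (Config d) ℂ) : Prop :=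
  ∀ k, (h k).IsHermitian ∧
    ∃ M : Matrix (InConfig d (N k)) (InConfig d (N k)) ℂ, h k = extendOp (N k) M

/-- Frustration-freeness of `∑ k, h k`: every global ground state is a ground state of every
term. -/
def IsFrustrationFree {ι : Type} [Fintype ι] {K : ℕ} (h : Fin K → Matrix ι ι ℂ) : Prop :=
  ∀ k, groundStates (∑ j, h j) ⊆ groundStates (h k)

/-- `|ψ⟩⟨ψ|` is the unique ground state of `H`: `ψ` is a ground state, and every ground state
defines the same pure state (that is, equals `ψ` up to a phase). -/
def IsUniqueGroundState {ι : Type} [Fintype ι] (H : Matrix ι ι ℂ) (ψ : ι → ℂ) : Prop :=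
  ψ ∈ groundStates H ∧ ∀ φ ∈ groundStates H, pureState φ = pureState ψ

end QuasiLocal

/-! Both conditions are equivalent to a third, `IsLocallyDetermined`: up to a phase, `ψ` is the only
unit vector that for every neighborhood has the form `(1 ⊗ Y) ψ` with `Y` acting outside it. Having
this form means that the reduced support on the neighborhood lies in that of `ψ`.

Necessity of this condition rests on commutation. Neighborhood Hamiltonians commute with `1 ⊗ Y`,
and neighborhood maps commute with conjugation by `1 ⊗ Y`. A vector `φ` of the above form for all
neighborhoods is therefore a ground state as soon as `ψ` is one, and its state is fixed by every map
that fixes the state of `ψ`; uniqueness or attraction then gives `φ = ψ` up to a phase. Conversely,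
the projections `Q k` onto the complements of the reduced supports sum to a frustration-free
Hamiltonian with unique ground state `ψ`.

For stabilization, cycle through the channels that measure `Q k` and, on outcome one, replace the
neighborhood by the completely mixed state. They fix `ψ`, so the fidelity with `ψ` never decreases.
Strict progress follows from `IsLocallyDetermined.eq_bot_of_invariant`: no nonzero subspace
orthogonal to `ψ` is invariant under all the Kraus operators. Hence in the Heisenberg picture
`|ψ⟩⟨ψ|` becomes positive definite after finitely many cycles (`exists_observable_posDef`), and the
infidelity contracts by a fixed factor over each such block (`tendsto_propagator`). -/

namespace QuasiLocal

/-! ### Local operators and reduced supports -/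

section LocalOperators

variable {n : ℕ} {d : Fin n → ℕ}

/-- The configuration `c` with its labels in `S` replaced by `m`. -/
def overwrite (S : Finset (Fin n)) (m : InConfig d S) (c : Config d) : Config d :=
  fun a => if h : a ∈ S then m ⟨a, h⟩ else c a

/-- The labels of the configuration `c` in `S`. -/
def labels (S : Finset (Fin n)) (c : Config d) : InConfig d S :=
  fun a => c a

theorem splitConfig_symm_snd (S : Finset (Fin n)) (m : InConfig d S) (c : Config d) :
    (splitConfig d S).symm (m, (splitConfig d S c).2) = overwrite S m c := by
  ext a
  by_cases h : a ∈ S <;>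
    simp [splitConfig, overwrite, h, Equiv.piEquivPiSubtypeProd]

/-- The operator `1 ⊗ Y` on the whole system, with `Y` acting on the subsystems outside `S`. -/
def outOp (S : Finset (Fin n)) (Y : Matrix (OutConfig d S) (OutConfig d S) ℂ) :
    Matrix (Config d) (Config d) ℂ :=
  Matrix.reindex (splitConfig d S).symm (splitConfig d S).symm
    ((1 : Matrix (InConfig d S) (InConfig d S) ℂ) ⊗ₖ Y)

theorem extendOp_mul (S : Finset (Fin n)) (A B : Matrix (InConfig d S) (InConfig d S) ℂ) :
    extendOp S (A * B) = extendOp S A * extendOp S B := by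
  simp [extendOp, Matrix.submatrix_mul_equiv, ← Matrix.mul_kronecker_mul]

theorem extendOp_add (S : Finset (Fin n)) (A B : Matrix (InConfig d S) (InConfig d S) ℂ) :
    extendOp S (A + B) = extendOp S A + extendOp S B := by
  simp only [extendOp, Matrix.add_kronecker]
  rfl

theorem extendOp_smul (S : Finset (Fin n)) (r : ℂ) (A : Matrix (InConfig d S) (InConfig d S) ℂ) :
    extendOp S (r • A) = r • extendOp S A := by
  simp only [extendOp, Matrix.smul_kronecker]
  rfl

theorem extendOp_one (S : Finset (Fin n)) :
    extendOp S (1 : Matrix (InConfig d S) (InConfig d S) ℂ) = 1 := by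
  simp [extendOp]

theorem extendOp_zero (S : Finset (Fin n)) :
    extendOp S (0 : Matrix (InConfig d S) (InConfig d S) ℂ) = 0 := by
  simp [extendOp]

theorem extendOp_sum {α : Type} (s : Finset α) (S : Finset (Fin n))
    (A : α → Matrix (InConfig d S) (InConfig d S) ℂ) :
    extendOp S (∑ i ∈ s, A i) = ∑ i ∈ s, extendOp S (A i) := by
  classical
  induction s using Finset.induction_on with
  | empty => simp [extendOp_zero]
  | insert a s ha ih => rw [Finset.sum_insert ha, Finset.sum_insert ha, extendOp_add, ih]

theorem extendOp_conjTranspose (S : Finset (Fin n)) (A : Matrix (InConfig d S) (InConfig d S) ℂ) :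
    (extendOp S A)ᴴ = extendOp S Aᴴ := by
  simp [extendOp, Matrix.conjTranspose_kronecker]

theorem extendOp_mul_outOp (S : Finset (Fin n)) (A : Matrix (InConfig d S) (InConfig d S) ℂ)
    (Y : Matrix (OutConfig d S) (OutConfig d S) ℂ) :
    extendOp S A * outOp S Y = outOp S Y * extendOp S A := by
  simp [extendOp, outOp, Matrix.submatrix_mul_equiv, ← Matrix.mul_kronecker_mul]

theorem extendOp_mulVec_apply (S : Finset (Fin n)) (A : Matrix (InConfig d S) (InConfig d S) ℂ)
    (φ : Config d → ℂ) (c : Config d) :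
    (extendOp S A *ᵥ φ) c = ∑ m, A (labels S c) m * φ (overwrite S m c) := by
  rw [Matrix.mulVec, dotProduct, ← Equiv.sum_comp (splitConfig d S).symm, Fintype.sum_prod_type]
  refine Finset.sum_congr rfl fun m _ => ?_
  rw [Finset.sum_eq_single (splitConfig d S c).2]
  · rw [splitConfig_symm_snd]
    simp only [extendOp, Matrix.reindex_apply, Equiv.symm_symm, Matrix.submatrix_apply,
      Matrix.kroneckerMap_apply, ← splitConfig_symm_snd, Equiv.apply_symm_apply,
      Matrix.one_apply_eq, mul_one]
    rfl
  · intro o _ ho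
    simp [extendOp, Matrix.one_apply_ne (Ne.symm ho)]
  · simp

theorem outOp_mulVec_symm (S : Finset (Fin n)) (Y : Matrix (OutConfig d S) (OutConfig d S) ℂ)
    (φ : Config d → ℂ) (i : InConfig d S) (o : OutConfig d S) :
    (outOp S Y *ᵥ φ) ((splitConfig d S).symm (i, o)) =
      ∑ p, Y o p * φ ((splitConfig d S).symm (i, p)) := by
  rw [Matrix.mulVec, dotProduct, ← Equiv.sum_comp (splitConfig d S).symm, Fintype.sum_prod_type]
  rw [Finset.sum_eq_single i]
  · simp [outOp]
  · intro o _ ho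
    simp [outOp, Matrix.one_apply_ne (Ne.symm ho)]
  · simp

theorem extendOp_mulVec_symm (S : Finset (Fin n)) (A : Matrix (InConfig d S) (InConfig d S) ℂ)
    (φ : Config d → ℂ) (i : InConfig d S) (o : OutConfig d S) :
    (extendOp S A *ᵥ φ) ((splitConfig d S).symm (i, o)) =
      ∑ p, A i p * φ ((splitConfig d S).symm (p, o)) := by
  rw [Matrix.mulVec, dotProduct, ← Equiv.sum_comp (splitConfig d S).symm,
    Fintype.sum_prod_type_right]
  rw [Finset.sum_eq_single o]
  · simp [extendOp]
  · intro o _ ho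
    simp [extendOp, Matrix.one_apply_ne (Ne.symm ho)]
  · simp

/-- The orthogonal projection onto the complement of the column space of a matrix. -/
theorem exists_projection_of_range {ι κ : Type} [Fintype ι] [DecidableEq ι] [Fintype κ]
    [DecidableEq κ] (B : Matrix ι κ ℂ) :
    ∃ Q : Matrix ι ι ℂ, Q.IsHermitian ∧ Q * Q = Q ∧
      ∀ C : Matrix ι κ ℂ, Q * C = 0 ↔ ∃ Y : Matrix κ κ ℂ, C = B * Y := by
  set W := LinearMap.range (Matrix.toEuclideanLin B) with hW
  set q : EuclideanSpace ℂ ι →L[ℂ] EuclideanSpace ℂ ι := Wᗮ.starProjection with hq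
  set Q : Matrix ι ι ℂ := Matrix.toEuclideanLin.symm q.toLinearMap with hQ
  have hQq : ∀ x, Q *ᵥ x = (q (WithLp.toLp 2 x)).ofLp := by
    intro x
    have : Matrix.toEuclideanLin Q = q.toLinearMap := by simp [hQ]
    have h := congrArg (fun l => (l (WithLp.toLp 2 x)).ofLp) this
    simpa using h
  have hker : ∀ x, Q *ᵥ x = 0 ↔ ∃ y, B *ᵥ y = x := by
    intro x
    rw [hQq]
    have h1 : (q (WithLp.toLp 2 x)).ofLp = 0 ↔ q (WithLp.toLp 2 x) = 0 := by
      constructor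
      · intro h; ext i; exact congrFun h i
      · intro h; rw [h]; rfl
    rw [h1, hq, Submodule.starProjection_apply_eq_zero_iff, Submodule.orthogonal_orthogonal, hW,
      LinearMap.mem_range]
    constructor
    · rintro ⟨y, hy⟩
      exact ⟨y.ofLp, by simpa using congrArg WithLp.ofLp hy⟩
    · rintro ⟨y, hy⟩
      exact ⟨WithLp.toLp 2 y, by rw [← hy]; simp⟩
  have hherm : Q.IsHermitian := by
    rw [← Matrix.isSymmetric_toEuclideanLin_iff]
    have : Matrix.toEuclideanLin Q = q.toLinearMap := by simp [hQ]
    rw [this]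
    exact Submodule.starProjection_isSymmetric (K := Wᗮ)
  refine ⟨Q, hherm, ?_, fun C => ⟨fun h => ?_, ?_⟩⟩
  · refine Matrix.ext_iff_mulVec.2 fun x => ?_
    rw [← Matrix.mulVec_mulVec, hQq x, hQq]
    have := Submodule.isIdempotentElem_starProjection Wᗮ
    have h2 := DFunLike.congr_fun this (WithLp.toLp 2 x)
    simpa [hq] using congrArg WithLp.ofLp h2
  · have : ∀ k, ∃ y, B *ᵥ y = C.col k := by
      intro k
      rw [← hker]
      ext i
      exact congrFun (congrFun h i) k
    choose y hy using this
    refine ⟨Matrix.of fun i k => y k i, ?_⟩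
    ext i k
    exact (congrFun (hy k) i).symm
  · rintro ⟨Y, rfl⟩
    ext i k
    have := (hker (B *ᵥ Y.col k)).2 ⟨_, rfl⟩
    have h3 := congrFun this i
    rw [Matrix.mulVec_mulVec] at h3
    rw [← Matrix.mul_assoc]
    exact h3

/-- The orthogonal projection onto the complement of the reduced support of `ψ` on `S`. -/
theorem exists_support_projection (S : Finset (Fin n)) (ψ : Config d → ℂ) :
    ∃ Q : Matrix (InConfig d S) (InConfig d S) ℂ, Q.IsHermitian ∧ Q * Q = Q ∧
      ∀ φ : Config d → ℂ, extendOp S Q *ᵥ φ = 0 ↔ ∃ Y, φ = outOp S Y *ᵥ ψ := by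
  -- Reshaped as a matrix with rows inside `S` and columns outside, `ψ` has the reduced support as
  -- its column space. Right multiplication by `Y` is then the action of `Yᵀ` outside `S`.
  obtain ⟨Q, h1, h2, h3⟩ := exists_projection_of_range
    (Matrix.of fun (i : InConfig d S) (o : OutConfig d S) => ψ ((splitConfig d S).symm (i, o)))
  refine ⟨Q, h1, h2, fun φ => ?_⟩
  have key := h3 (Matrix.of fun i o => φ ((splitConfig d S).symm (i, o)))
  have e1 : extendOp S Q *ᵥ φ = 0 ↔
      Q * (Matrix.of fun i o => φ ((splitConfig d S).symm (i, o))) = 0 := by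
    constructor
    · intro h
      ext i o
      have := congrFun h ((splitConfig d S).symm (i, o))
      rw [extendOp_mulVec_symm] at this
      simpa [Matrix.mul_apply] using this
    · intro h
      ext c
      obtain ⟨⟨i, o⟩, rfl⟩ := (splitConfig d S).symm.surjective c
      rw [extendOp_mulVec_symm]
      simpa [Matrix.mul_apply] using congrFun (congrFun h i) o
  rw [e1, key]
  constructor
  · rintro ⟨Y, hY⟩
    refine ⟨Yᵀ, ?_⟩
    ext c
    obtain ⟨⟨i, o⟩, rfl⟩ := (splitConfig d S).symm.surjective c
    rw [outOp_mulVec_symm]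
    simpa [Matrix.mul_apply, mul_comm] using congrFun (congrFun hY i) o
  · rintro ⟨Y, rfl⟩
    refine ⟨Yᵀ, ?_⟩
    ext i o
    simp only [Matrix.of_apply]
    rw [outOp_mulVec_symm]
    simp [Matrix.mul_apply, mul_comm]

end LocalOperators

/-! ### Pure states, energies and ground states -/

section PureStates

variable {ι : Type} [Fintype ι]

theorem mul_pureState_mul (A : Matrix ι ι ℂ) (φ : ι → ℂ) :
    A * pureState φ * Aᴴ = pureState (A *ᵥ φ) := by
  rw [pureState, pureState, Matrix.mul_vecMulVec, Matrix.vecMulVec_mul, Matrix.star_mulVec]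

theorem pureState_mulVec (φ χ : ι → ℂ) : pureState φ *ᵥ χ = (star φ ⬝ᵥ χ) • φ := by
  ext i
  simp [pureState, Matrix.vecMulVec_mulVec, mul_comm]

theorem pureState_posSemidef (φ : ι → ℂ) : (pureState φ).PosSemidef :=
  Matrix.posSemidef_vecMulVec_self_star φ

theorem isDensity_pureState {φ : ι → ℂ} (h : IsUnitVec φ) : IsDensity (pureState φ) := by
  refine ⟨pureState_posSemidef φ, ?_⟩
  rw [pureState, Matrix.trace_vecMulVec, dotProduct_comm]
  exact h

theorem exists_isUnitVec_smul {φ : ι → ℂ} (h : φ ≠ 0) : ∃ r : ℂ, r ≠ 0 ∧ IsUnitVec (r • φ) := by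
  have h0 : 0 < star φ ⬝ᵥ φ := Matrix.dotProduct_star_self_pos_iff.2 h
  obtain ⟨hre, him⟩ := Complex.pos_iff.1 h0
  have hs : (0 : ℝ) < Real.sqrt (star φ ⬝ᵥ φ).re := Real.sqrt_pos.2 hre
  refine ⟨((Real.sqrt (star φ ⬝ᵥ φ).re)⁻¹ : ℝ), by exact_mod_cast (inv_pos.2 hs).ne', ?_⟩
  rw [IsUnitVec, star_smul, smul_dotProduct, dotProduct_smul]
  have h1 : star φ ⬝ᵥ φ = ((star φ ⬝ᵥ φ).re : ℂ) := Complex.ext rfl (by simp [← him])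
  rw [h1, Complex.star_def, Complex.conj_ofReal, smul_eq_mul, smul_eq_mul]
  norm_cast
  have h2 := Real.mul_self_sqrt hre.le
  field_simp
  nlinarith

theorem energy_sum {κ : Type} (s : Finset κ) (h : κ → Matrix ι ι ℂ) (φ : ι → ℂ) :
    energy (∑ k ∈ s, h k) φ = ∑ k ∈ s, energy (h k) φ := by
  simp [energy, Matrix.sum_mulVec, dotProduct_sum]

theorem energy_of_eigenvector {A : Matrix ι ι ℂ} {φ : ι → ℂ} (hφ : IsUnitVec φ) {e : ℝ}
    (h : A *ᵥ φ = (e : ℂ) • φ) : energy A φ = e := by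
  rw [energy, h, dotProduct_smul, hφ]
  simp

theorem energy_smul (A : Matrix ι ι ℂ) (r : ℂ) (φ : ι → ℂ) :
    energy A (r • φ) = Complex.normSq r * energy A φ := by
  rw [energy, energy, Matrix.mulVec_smul, star_smul, smul_dotProduct, dotProduct_smul,
    smul_eq_mul, smul_eq_mul, ← mul_assoc, Complex.star_def, Complex.normSq_eq_conj_mul_self.symm,
    Complex.re_ofReal_mul]

/-- A ground state is an eigenvector for its energy. -/
theorem mulVec_eq_of_mem_groundStates [DecidableEq ι] {A : Matrix ι ι ℂ} (hA : A.IsHermitian)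
    {ψ : ι → ℂ} (hψ : ψ ∈ groundStates A) : A *ᵥ ψ = (energy A ψ : ℂ) • ψ := by
  set e := energy A ψ with he
  -- Minimality makes `A - e` positive semidefinite with vanishing expectation at `ψ`, so it
  -- annihilates `ψ`.
  set B : Matrix ι ι ℂ := A - (e : ℂ) • 1 with hB
  have hBe : ∀ φ, energy B φ = energy A φ - e * energy 1 φ := by
    intro φ
    simp [energy, hB, Matrix.sub_mulVec, Matrix.smul_mulVec, dotProduct_sub, dotProduct_smul]
  have h1 : ∀ φ : ι → ℂ, IsUnitVec φ → energy 1 φ = 1 := by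
    intro φ hφ
    rw [energy, Matrix.one_mulVec, hφ, Complex.one_re]
  have hBh : B.IsHermitian := by
    refine hA.sub ?_
    rw [Matrix.IsHermitian, Matrix.conjTranspose_smul]
    simp
  have him : ∀ φ, (star φ ⬝ᵥ (B *ᵥ φ)).im = 0 := fun φ => hBh.im_star_dotProduct_mulVec_self φ
  have hps : B.PosSemidef := by
    refine Matrix.PosSemidef.of_dotProduct_mulVec_nonneg hBh fun φ => ?_
    rw [Complex.nonneg_iff]
    refine ⟨?_, (him φ).symm⟩
    by_cases h0 : φ = 0
    · simp [h0]
    obtain ⟨r, hr, hu⟩ := exists_isUnitVec_smul h0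
    have := hψ.2 _ hu
    have h2 : 0 ≤ energy B (r • φ) := by rw [hBe, h1 _ hu]; linarith
    rw [energy_smul] at h2
    exact nonneg_of_mul_nonneg_right h2 (Complex.normSq_pos.2 hr)
  have h0 : star ψ ⬝ᵥ (B *ᵥ ψ) = 0 := by
    refine Complex.ext ?_ (him ψ)
    have := hBe ψ
    rw [h1 _ hψ.1] at this
    rw [energy] at this
    rw [this]; simp [he]
  have h3 := (hps.dotProduct_mulVec_zero_iff ψ).1 h0
  rw [hB, Matrix.sub_mulVec, Matrix.smul_mulVec, Matrix.one_mulVec, sub_eq_zero] at h3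
  exact h3

end PureStates

/-! ### Local determination: Hamiltonians, and necessity for stabilization -/

section Determined

variable {n K : ℕ} {d : Fin n → ℕ}

/-- `ψ` is, up to a phase, the only unit vector whose reduced supports on all neighborhoods are
contained in those of `ψ`. -/
def IsLocallyDetermined (N : Fin K → Finset (Fin n)) (ψ : Config d → ℂ) : Prop :=
  ∀ φ, IsUnitVec φ → (∀ k, ∃ Y, φ = outOp (N k) Y *ᵥ ψ) → pureState φ = pureState ψ

/-- Frustration-freeness makes `ψ` an eigenvector of every `h k`. Since `h k` commutes with `1 ⊗ Y`,
the vector `φ` is an eigenvector with the same eigenvalue, so it has the total energy of `ψ`. -/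
theorem isLocallyDetermined_of_hamiltonian {N : Fin K → Finset (Fin n)} {ψ : Config d → ℂ}
    {h : Fin K → Matrix (Config d) (Config d) ℂ} (hq : IsQuasiLocalHamiltonian N h)
    (hf : IsFrustrationFree h) (hu : IsUniqueGroundState (∑ k, h k) ψ) :
    IsLocallyDetermined N ψ := by
  intro φ hφ hs
  have heig : ∀ k, h k *ᵥ ψ = (energy (h k) ψ : ℂ) • ψ := fun k =>
    mulVec_eq_of_mem_groundStates (hq k).1 (hf k hu.1)
  have heφ : ∀ k, energy (h k) φ = energy (h k) ψ := by
    intro k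
    refine energy_of_eigenvector hφ ?_
    obtain ⟨Y, hY⟩ := hs k
    obtain ⟨M, hM⟩ := (hq k).2
    have hk := heig k
    rw [hY, Matrix.mulVec_mulVec]
    nth_rewrite 1 [hM]
    rw [extendOp_mul_outOp, ← hM, ← Matrix.mulVec_mulVec, hk, Matrix.mulVec_smul]
  refine hu.2 φ ⟨hφ, fun χ hχ => ?_⟩
  have : energy (∑ k, h k) φ = energy (∑ k, h k) ψ := by
    rw [energy_sum, energy_sum]
    exact Finset.sum_congr rfl fun k _ => heφ k
  rw [this]
  exact hu.1.2 χ hχ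

/-- The terms are the projections onto the complements of the reduced supports. All annihilate `ψ`,
so the ground energy is zero and the ground states are exactly the unit vectors in the common
kernel. -/
theorem IsLocallyDetermined.exists_hamiltonian {N : Fin K → Finset (Fin n)} {ψ : Config d → ℂ}
    (hψ : IsUnitVec ψ) (hd : IsLocallyDetermined N ψ) :
    ∃ h : Fin K → Matrix (Config d) (Config d) ℂ, IsQuasiLocalHamiltonian N h ∧
      IsFrustrationFree h ∧ IsUniqueGroundState (∑ k, h k) ψ := by
  choose Q hQh hQi hQ using fun k => exists_support_projection (N k) ψ
  set h : Fin K → Matrix (Config d) (Config d) ℂ := fun k => extendOp (N k) (Q k) with hh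
  have hps : ∀ k, (h k).PosSemidef := by
    intro k
    have : h k = (extendOp (N k) (Q k))ᴴ * extendOp (N k) (Q k) := by
      rw [extendOp_conjTranspose, hQh k, ← extendOp_mul, hQi k]
    rw [this]
    exact Matrix.posSemidef_conjTranspose_mul_self _
  have hpos : ∀ k φ, 0 ≤ energy (h k) φ := fun k φ => (hps k).re_dotProduct_nonneg φ
  have hpos' : ∀ φ, 0 ≤ energy (∑ k, h k) φ := by
    intro φ
    rw [energy_sum]
    exact Finset.sum_nonneg fun k _ => hpos k φ
  have hψ0 : ∀ k, h k *ᵥ ψ = 0 := by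
    intro k
    rw [hh, hQ k]
    exact ⟨1, by simp [outOp]⟩
  have hψe : energy (∑ k, h k) ψ = 0 := by
    rw [energy_sum]
    exact Finset.sum_eq_zero fun k _ => by simp [energy, hψ0 k]
  have hg : ψ ∈ groundStates (∑ k, h k) := ⟨hψ, fun φ _ => by rw [hψe]; exact hpos' φ⟩
  have hzero : ∀ φ ∈ groundStates (∑ k, h k), ∀ k, energy (h k) φ = 0 := by
    intro φ hφ k
    have h1 : energy (∑ k, h k) φ = 0 := le_antisymm (hψe ▸ hφ.2 ψ hψ) (hpos' φ)
    rw [energy_sum, Finset.sum_eq_zero_iff_of_nonneg fun k _ => hpos k φ] at h1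
    exact h1 k (Finset.mem_univ k)
  refine ⟨h, fun k => ⟨(hps k).1, Q k, rfl⟩, fun k φ hφ => ⟨hφ.1, fun χ _ => ?_⟩, hg,
    fun φ hφ => hd φ hφ.1 fun k => ?_⟩
  · rw [hzero φ hφ k]
    exact hpos k χ
  · rw [← hQ k, ← (hps k).dotProduct_mulVec_zero_iff φ]
    exact Complex.ext (hzero φ hφ k) ((hps k).1.im_star_dotProduct_mulVec_self φ)

theorem outOp_mul_apply (S : Finset (Fin n)) (Y : Matrix (OutConfig d S) (OutConfig d S) ℂ)
    (X : Matrix (Config d) (Config d) ℂ) (p q : InConfig d S × OutConfig d S) :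
    (outOp S Y * X * (outOp S Y)ᴴ) ((splitConfig d S).symm p) ((splitConfig d S).symm q) =
      ∑ a, ∑ b, Y p.2 a * star (Y q.2 b) *
        X ((splitConfig d S).symm (p.1, a)) ((splitConfig d S).symm (q.1, b)) := by
  have h1 : ∀ (Z : Matrix (Config d) (Config d) ℂ) (c : Config d),
      (outOp S Y * Z) ((splitConfig d S).symm p) c =
        ∑ a, Y p.2 a * Z ((splitConfig d S).symm (p.1, a)) c := fun Z c =>
    outOp_mulVec_symm S Y (fun x => Z x c) p.1 p.2
  have h2 : ∀ (Z : Matrix (Config d) (Config d) ℂ) (c : Config d),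
      (Z * (outOp S Y)ᴴ) c ((splitConfig d S).symm q) =
        ∑ b, Z c ((splitConfig d S).symm (q.1, b)) * star (Y q.2 b) := by
    intro Z c
    have := outOp_mulVec_symm S Y (fun x => star (Z c x)) q.1 q.2
    have h3 := congrArg star this
    simp only [Matrix.mulVec, dotProduct, star_sum, star_mul', star_star] at h3
    simp only [Matrix.mul_apply, Matrix.conjTranspose_apply]
    simpa only [mul_comm] using h3
  rw [Matrix.mul_assoc, h1]
  refine Finset.sum_congr rfl fun a _ => ?_
  rw [h2, Finset.mul_sum]
  exact Finset.sum_congr rfl fun b _ => by ring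

theorem extendMap_apply_symm (S : Finset (Fin n)) (F : SuperOp (InConfig d S))
    (X : Matrix (Config d) (Config d) ℂ) (p q : InConfig d S × OutConfig d S) :
    extendMap S F X ((splitConfig d S).symm p) ((splitConfig d S).symm q) =
      F (Matrix.of fun a b =>
        X ((splitConfig d S).symm (a, p.2)) ((splitConfig d S).symm (b, q.2))) p.1 q.1 := by
  simp [extendMap, tensorId]
  rfl

/-- Conjugation by `1 ⊗ Y` only forms linear combinations of the blocks to which `F` is applied, so
linearity of `F` suffices. -/
theorem extendMap_outOp (S : Finset (Fin n)) (F : SuperOp (InConfig d S))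
    (Y : Matrix (OutConfig d S) (OutConfig d S) ℂ) (X : Matrix (Config d) (Config d) ℂ) :
    extendMap S F (outOp S Y * X * (outOp S Y)ᴴ) =
      outOp S Y * extendMap S F X * (outOp S Y)ᴴ := by
  ext c c'
  obtain ⟨p, rfl⟩ := (splitConfig d S).symm.surjective c
  obtain ⟨q, rfl⟩ := (splitConfig d S).symm.surjective c'
  rw [outOp_mul_apply, extendMap_apply_symm]
  have : (Matrix.of fun a b => (outOp S Y * X * (outOp S Y)ᴴ)
      ((splitConfig d S).symm (a, p.2)) ((splitConfig d S).symm (b, q.2))) =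
      ∑ a, ∑ b, (Y p.2 a * star (Y q.2 b)) • Matrix.of fun i j =>
        X ((splitConfig d S).symm (i, a)) ((splitConfig d S).symm (j, b)) := by
    ext i j
    rw [Matrix.of_apply, outOp_mul_apply]
    simp [Matrix.sum_apply]
  rw [this]
  simp only [map_sum, map_smul, Matrix.sum_apply, Matrix.smul_apply, smul_eq_mul,
    extendMap_apply_symm]

theorem IsQLS.isLocallyDetermined {N : Fin K → Finset (Fin n)} {ψ : Config d → ℂ}
    (h : IsQLS N (pureState ψ)) : IsLocallyDetermined N ψ := by
  obtain ⟨E, hE, hinv, hlim⟩ := h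
  intro φ hφ hs
  have hfix : ∀ t, E t (pureState φ) = pureState φ := by
    intro t
    obtain ⟨j, F, -, hF⟩ := hE t
    have h1 : E t (pureState ψ) = pureState ψ := hinv t 1
    obtain ⟨Y, hY⟩ := hs j
    rw [hY, ← mul_pureState_mul, hF, extendMap_outOp, ← hF, h1]
  have hprop : ∀ k, propagator E 0 k (pureState φ) = pureState φ := by
    intro k
    induction k with
    | zero => rfl
    | succ k ih => rw [propagator, LinearMap.comp_apply, ih, hfix]
  have := hlim _ (isDensity_pureState hφ) 0
  simp only [hprop] at this
  exact tendsto_nhds_unique tendsto_const_nhds this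

end Determined

/-! ### Invariant subspaces orthogonal to a locally determined vector -/

section Invariant

variable {n K : ℕ} {d : Fin n → ℕ}

/-- The operator `|u_L⟩⟨w_L| ⊗ 1`, where `u_L` and `w_L` are the restrictions to `L` of the
configurations `u` and `w`. -/
def unitOp (L : Finset (Fin n)) (u w : Config d) (φ : Config d → ℂ) : Config d → ℂ :=
  fun c => if ∀ a ∈ L, c a = u a then φ (L.piecewise w c) else 0

theorem unitOp_empty (u w : Config d) (φ : Config d → ℂ) : unitOp ∅ u w φ = φ := by
  ext c
  simp [unitOp]

theorem overwrite_restrict (M : Finset (Fin n)) (w c : Config d) :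
    overwrite M (labels M w) c = M.piecewise w c := by
  ext a
  by_cases h : a ∈ M <;> simp [overwrite, labels, h]

theorem unitOp_eq_extendOp (M : Finset (Fin n)) (u w : Config d) (φ : Config d → ℂ) :
    unitOp M u w φ = extendOp M (Matrix.single (labels M u) (labels M w) 1) *ᵥ φ := by
  ext c
  simp only [extendOp_mulVec_apply, Matrix.single_apply]
  rw [Finset.sum_eq_single (labels M w)]
  · rw [overwrite_restrict, unitOp]
    have : (∀ a ∈ M, c a = u a) ↔ labels M u = labels M c := by
      rw [funext_iff]
      exact ⟨fun h a => (h a a.2).symm, fun h a ha => (h ⟨a, ha⟩).symm⟩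
    by_cases h : ∀ a ∈ M, c a = u a
    · rw [if_pos h, if_pos ⟨this.1 h, rfl⟩, one_mul]
    · rw [if_neg h, if_neg (fun h' => h (this.2 h'.1)), zero_mul]
  · intro m _ hm
    rw [if_neg (fun h => hm h.2.symm), zero_mul]
  · simp

theorem unitOp_unitOp_sdiff (L M : Finset (Fin n)) (u w : Config d) (φ : Config d → ℂ) :
    unitOp M u w (unitOp (L \ M) u w φ) = unitOp (L ∪ M) u w φ := by
  ext c
  simp only [unitOp]
  have h1 : (L \ M).piecewise w (M.piecewise w c) = (L ∪ M).piecewise w c := by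
    ext a
    by_cases hL : a ∈ L <;> by_cases hM : a ∈ M <;> simp [Finset.piecewise, hL, hM]
  rw [h1]
  by_cases hM : ∀ a ∈ M, c a = u a
  · have h2 : (∀ a ∈ L \ M, M.piecewise w c a = u a) ↔ ∀ a ∈ L ∪ M, c a = u a := by
      constructor
      · intro h a ha
        by_cases haM : a ∈ M
        · exact hM a haM
        · have haL : a ∈ L := (Finset.mem_union.1 ha).resolve_right haM
          simpa [haM] using h a (Finset.mem_sdiff.2 ⟨haL, haM⟩)
      · intro h a ha
        rw [Finset.mem_sdiff] at ha
        simpa [ha.2] using h a (Finset.mem_union_left _ ha.1)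
    rw [if_pos hM]
    exact if_congr h2 rfl rfl
  · rw [if_neg hM, if_neg fun h => hM fun a ha => h a (Finset.mem_union_right _ ha)]

theorem unitOp_extendOp {L M : Finset (Fin n)} (hd : Disjoint L M) (u w : Config d)
    (A : Matrix (InConfig d M) (InConfig d M) ℂ) (φ : Config d → ℂ) :
    unitOp L u w (extendOp M A *ᵥ φ) = extendOp M A *ᵥ unitOp L u w φ := by
  ext c
  rw [unitOp, extendOp_mulVec_apply, extendOp_mulVec_apply]
  have hnot : ∀ a ∈ M, a ∉ L := fun a ha h => Finset.disjoint_left.1 hd h ha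
  have hnot' : ∀ a ∈ L, a ∉ M := fun a ha h => Finset.disjoint_left.1 hd ha h
  have h1 : ∀ m : InConfig d M, (∀ a ∈ L, overwrite M m c a = u a) ↔ ∀ a ∈ L, c a = u a := by
    intro m
    refine forall₂_congr fun a ha => ?_
    simp [overwrite, hnot' a ha]
  have h2 : ∀ m : InConfig d M,
      overwrite M m (L.piecewise w c) = L.piecewise w (overwrite M m c) := by
    intro m
    ext a
    by_cases hM : a ∈ M
    · simp [overwrite, hM, hnot a hM]
    · by_cases hL : a ∈ L <;> simp [overwrite, hM, hL]
  have h3 : labels M (L.piecewise w c) = labels M c := by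
    ext a
    simp [labels, hnot a a.2]
  simp only [unitOp, h1, h2, h3]
  by_cases h : ∀ a ∈ L, c a = u a
  · simp [if_pos h]
  · simp [if_neg h]

/-- Products of matrix units are matrix units or zero; thus acting on `L \ M` after `L` does not
leave the operators on `L`. This is what preserves saturation in `IsSaturated.union`. -/
theorem unitOp_sdiff_unitOp (L M : Finset (Fin n)) (u w u' w' : Config d) (φ : Config d → ℂ) :
    unitOp (L \ M) u' w' (unitOp L u w φ) =
      if ∀ a ∈ L \ M, w' a = u a then unitOp L ((L \ M).piecewise u' u) w φ else 0 := by
  ext c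
  have h1 : L.piecewise w ((L \ M).piecewise w' c) = L.piecewise w c := by
    ext a
    by_cases hL : a ∈ L <;> simp [hL]
  simp only [unitOp, h1]
  by_cases hw : ∀ a ∈ L \ M, w' a = u a
  · rw [if_pos hw]
    simp only [unitOp]
    rw [← ite_and]
    refine if_congr ⟨fun h a ha => ?_, fun h => ⟨fun a ha => ?_, fun a ha => ?_⟩⟩ rfl rfl
    · by_cases haM : a ∈ L \ M
      · simpa [haM] using h.1 a haM
      · simpa [haM] using h.2 a ha
    · simpa [ha] using h a (Finset.mem_sdiff.1 ha).1
    · by_cases haM : a ∈ L \ M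
      · simpa [haM] using hw a haM
      · simpa [haM] using h a ha
  · rw [if_neg hw, if_neg (c := ∀ a ∈ L, (L \ M).piecewise w' c a = u a), ite_self]
    · rfl
    · intro h
      refine hw fun a ha => ?_
      simpa [ha] using h a (Finset.mem_sdiff.1 ha).1

/-- All operators on the subsystems in `L` map `φ` into `S`. -/
def IsSaturated (S : Submodule ℂ (Config d → ℂ)) (L : Finset (Fin n)) (φ : Config d → ℂ) : Prop :=
  ∀ u w, unitOp L u w φ ∈ S

/-- A matrix unit on `L ∪ M` factors into one on `L \ M` and one on `M`. The first commutes with `Q`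
and is absorbed by the saturation on `L`; the second combines with `Q` into an operator that
preserves `S`. -/
theorem IsSaturated.union {S : Submodule ℂ (Config d → ℂ)} {L M : Finset (Fin n)}
    {φ : Config d → ℂ} (hφ : IsSaturated S L φ) {Q : Matrix (InConfig d M) (InConfig d M) ℂ}
    (hinv : ∀ i j, ∀ χ ∈ S, extendOp M (Matrix.single i j 1 * Q) *ᵥ χ ∈ S) (u w : Config d) :
    IsSaturated S (L ∪ M) (extendOp M Q *ᵥ unitOp L u w φ) := by
  intro u' w'
  rw [← unitOp_unitOp_sdiff, unitOp_extendOp Finset.sdiff_disjoint, unitOp_eq_extendOp M,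
    Matrix.mulVec_mulVec, ← extendOp_mul]
  refine hinv _ _ _ ?_
  rw [unitOp_sdiff_unitOp]
  split_ifs
  · exact hφ _ _
  · exact S.zero_mem

/-- The product of the slice of `ψ` at `c₁` outside `L` with the slice of `φ` at `c₀` in `L`. -/
def sliceProduct (L : Finset (Fin n)) (c₀ c₁ : Config d) (ψ φ : Config d → ℂ) : Config d → ℂ :=
  fun c => ψ (L.piecewise c c₁) * φ (L.piecewise c₀ c)

theorem sliceProduct_eq_sum (L : Finset (Fin n)) (c₀ c₁ : Config d) (ψ φ : Config d → ℂ) :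
    sliceProduct L c₀ c₁ ψ φ =
      ∑ u, (if L.piecewise u c₁ = u then ψ u else 0) • unitOp L u c₀ φ := by
  ext c
  -- Requiring `u` to agree with `c₁` outside `L` counts each labelling of `L` once.
  rw [Finset.sum_apply, Finset.sum_eq_single (L.piecewise c c₁)]
  · rw [Pi.smul_apply, if_pos (by simp), unitOp, if_pos fun a ha => by simp [ha]]
    rfl
  · intro u _ hu
    by_cases h1 : L.piecewise u c₁ = u
    · rw [Pi.smul_apply, unitOp, if_neg (c := ∀ a ∈ L, c a = u a), smul_zero]
      intro h
      refine hu ?_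
      rw [← h1]
      ext a
      by_cases ha : a ∈ L
      · simp [ha, h a ha]
      · simp [ha]
    · simp [if_neg h1]
  · simp

theorem extendOp_sliceProduct {L M : Finset (Fin n)} (h : M ⊆ L) (c₀ c₁ : Config d)
    (ψ φ : Config d → ℂ) (A : Matrix (InConfig d M) (InConfig d M) ℂ) :
    extendOp M A *ᵥ sliceProduct L c₀ c₁ ψ φ = sliceProduct L c₀ c₁ (extendOp M A *ᵥ ψ) φ := by
  ext c
  rw [sliceProduct, extendOp_mulVec_apply, extendOp_mulVec_apply, Finset.sum_mul]
  refine Finset.sum_congr rfl fun m _ => ?_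
  have h1 : L.piecewise (overwrite M m c) c₁ = overwrite M m (L.piecewise c c₁) := by
    ext a
    by_cases hM : a ∈ M
    · simp [overwrite, hM, h hM]
    · by_cases hL : a ∈ L <;> simp [overwrite, hM, hL]
  have h2 : L.piecewise c₀ (overwrite M m c) = L.piecewise c₀ c := by
    ext a
    by_cases hL : a ∈ L
    · simp [hL]
    · have hM : a ∉ M := fun hM => hL (h hM)
      simp [hL, overwrite, hM]
  have h3 : labels M (L.piecewise c c₁) = labels M c := by
    ext a
    simp [labels, h a.2]
  rw [sliceProduct, h1, h2, h3, mul_assoc]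

/-- If `ψ` is locally determined, then no nonzero subspace orthogonal to `ψ` is invariant under
the operators that detect a local deviation from `ψ` and reset the neighborhood. -/
theorem IsLocallyDetermined.eq_bot_of_invariant {N : Fin K → Finset (Fin n)} {ψ : Config d → ℂ}
    (hψ : IsUnitVec ψ) (hd : IsLocallyDetermined N ψ)
    {Q : ∀ k, Matrix (InConfig d (N k)) (InConfig d (N k)) ℂ}
    (hQ : ∀ k φ, extendOp (N k) (Q k) *ᵥ φ = 0 ↔ ∃ Y, φ = outOp (N k) Y *ᵥ ψ)
    (S : Submodule ℂ (Config d → ℂ))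
    (hinv : ∀ k i j, ∀ φ ∈ S, extendOp (N k) (Matrix.single i j 1 * Q k) *ᵥ φ ∈ S)
    (horth : ∀ φ ∈ S, star ψ ⬝ᵥ φ = 0) : S = ⊥ := by
  suffices key : ∀ (L : Finset (Fin n)) (φ : Config d → ℂ), φ ≠ 0 → ¬ IsSaturated S L φ by
    rw [Submodule.eq_bot_iff]
    intro φ hφ
    by_contra h0
    exact key ∅ φ h0 fun u w => by rwa [unitOp_empty]
  intro L
  -- The induction goes from larger sets to smaller ones. If `Q k` detects a deviation while `N k`
  -- is not contained in `L`, the detected vector is saturated on the strictly larger set `L ∪ N k`.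
  induction L using WellFoundedGT.induction with
  | ind L ih =>
  intro φ hφ0 hφ
  have hloc : ∀ k, ¬ N k ⊆ L → ∀ u w, extendOp (N k) (Q k) *ᵥ unitOp L u w φ = 0 := by
    intro k hk u w
    by_contra h
    refine ih (L ∪ N k) ?_ _ h (hφ.union (hinv k) u w)
    refine Finset.ssubset_iff_subset_ne.2 ⟨Finset.subset_union_left, fun he => hk ?_⟩
    rw [he]
    exact Finset.subset_union_right
  have hψ0 : ψ ≠ 0 := by
    rintro rfl
    simp [IsUnitVec] at hψ
  obtain ⟨c₀, hc₀⟩ := Function.ne_iff.1 hφ0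
  obtain ⟨c₁, hc₁⟩ := Function.ne_iff.1 hψ0
  -- This vector looks like `ψ` inside `L` and like `φ` outside. Every `Q k` annihilates it: by the
  -- factor from `ψ` if `N k ⊆ L`, and by `hloc` otherwise. Local determination then forces `ψ ∈ S`.
  set χ := sliceProduct L c₀ c₁ ψ φ with hχ
  have hχ0 : χ ≠ 0 := by
    intro h
    have h1 := congrFun h (L.piecewise c₁ c₀)
    rw [hχ, sliceProduct] at h1
    simp only [Finset.piecewise_piecewise_of_subset_left subset_rfl,
      Finset.piecewise_piecewise_of_subset_right subset_rfl, Finset.piecewise_same] at h1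
    exact mul_ne_zero hc₁ hc₀ h1
  have hχS : χ ∈ S := by
    rw [hχ, sliceProduct_eq_sum]
    exact S.sum_mem fun u _ => S.smul_mem _ (hφ _ _)
  have hχQ : ∀ k, extendOp (N k) (Q k) *ᵥ χ = 0 := by
    intro k
    by_cases hk : N k ⊆ L
    · rw [hχ, extendOp_sliceProduct hk, (hQ k ψ).2 ⟨1, by simp [outOp]⟩]
      ext c
      simp [sliceProduct]
    · rw [hχ, sliceProduct_eq_sum, Matrix.mulVec_sum]
      refine Finset.sum_eq_zero fun u _ => ?_
      rw [Matrix.mulVec_smul, hloc k hk, smul_zero]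
  obtain ⟨r, hr, hu⟩ := exists_isUnitVec_smul hχ0
  have h1 := hd (r • χ) hu fun k => (hQ k _).1 (by rw [Matrix.mulVec_smul, hχQ k, smul_zero])
  have h2 : ψ ∈ S := by
    have h3 := congrArg (fun A => A *ᵥ ψ) h1
    simp only [pureState_mulVec] at h3
    rw [hψ, one_smul] at h3
    rw [← h3]
    exact S.smul_mem _ (S.smul_mem _ hχS)
  have h4 := horth ψ h2
  rw [hψ] at h4
  exact one_ne_zero h4

end Invariant

/-! ### Kraus maps and the measure-and-reset channel -/

section Kraus

variable {ι α : Type} [Fintype ι] [Fintype α]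

/-- The map `X ↦ ∑ i, A i * X * (A i)ᴴ` with Kraus operators `A i`. -/
def krausMap (A : α → Matrix ι ι ℂ) : SuperOp ι where
  toFun X := ∑ i, A i * X * (A i)ᴴ
  map_add' X Y := by simp [Matrix.mul_add, Matrix.add_mul, Finset.sum_add_distrib]
  map_smul' r X := by simp [Finset.smul_sum]

theorem krausMap_apply (A : α → Matrix ι ι ℂ) (X : Matrix ι ι ℂ) :
    krausMap A X = ∑ i, A i * X * (A i)ᴴ := rfl

theorem krausMap_posSemidef (A : α → Matrix ι ι ℂ) {X : Matrix ι ι ℂ} (hX : X.PosSemidef) :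
    (krausMap A X).PosSemidef :=
  Matrix.posSemidef_sum _ fun i _ => hX.mul_mul_conjTranspose_same (A i)

theorem trace_mul_krausMap (A : α → Matrix ι ι ℂ) (X Y : Matrix ι ι ℂ) :
    (Y * krausMap A X).trace = (krausMap (fun i => (A i)ᴴ) Y * X).trace := by
  simp only [krausMap_apply, Matrix.mul_sum, Matrix.sum_mul, Matrix.trace_sum,
    Matrix.conjTranspose_conjTranspose]
  refine Finset.sum_congr rfl fun i _ => ?_
  rw [← Matrix.mul_assoc, Matrix.trace_mul_comm]
  simp only [Matrix.mul_assoc]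

theorem trace_krausMap [DecidableEq ι] {A : α → Matrix ι ι ℂ} (hA : ∑ i, (A i)ᴴ * A i = 1)
    (X : Matrix ι ι ℂ) : (krausMap A X).trace = X.trace := by
  have := trace_mul_krausMap A X 1
  rw [one_mul] at this
  rw [this, krausMap_apply]
  simp only [Matrix.conjTranspose_conjTranspose, mul_one, hA, one_mul]

theorem tensorId_krausMap {κ : Type} [Fintype κ] [DecidableEq κ] (A : α → Matrix ι ι ℂ) :
    tensorId κ (krausMap A) = krausMap fun i => A i ⊗ₖ (1 : Matrix κ κ ℂ) := by
  refine LinearMap.ext fun X => ?_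
  have h1 : ∀ (B : Matrix ι ι ℂ) (Z : Matrix (ι × κ) (ι × κ) ℂ) (p q : ι × κ),
      (B ⊗ₖ (1 : Matrix κ κ ℂ) * Z) p q = ∑ a, B p.1 a * Z (a, p.2) q := by
    intro B Z p q
    rw [Matrix.mul_apply, Fintype.sum_prod_type]
    refine Finset.sum_congr rfl fun a _ => ?_
    rw [Finset.sum_eq_single p.2]
    · simp
    · intro b _ hb
      simp [Matrix.one_apply_ne (Ne.symm hb)]
    · simp
  have h2 : ∀ (B : Matrix ι ι ℂ) (Z : Matrix (ι × κ) (ι × κ) ℂ) (p q : ι × κ),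
      (Z * (B ⊗ₖ (1 : Matrix κ κ ℂ))ᴴ) p q = ∑ a, Z p (a, q.2) * star (B q.1 a) := by
    intro B Z p q
    rw [Matrix.mul_apply, Fintype.sum_prod_type]
    refine Finset.sum_congr rfl fun a _ => ?_
    rw [Finset.sum_eq_single q.2]
    · simp
    · intro b _ hb
      simp [Matrix.one_apply_ne (Ne.symm hb)]
    · simp
  ext p q
  simp only [tensorId, LinearMap.coe_mk, AddHom.coe_mk, Matrix.of_apply, krausMap_apply,
    Matrix.sum_apply]
  refine Finset.sum_congr rfl fun i _ => ?_
  rw [h2, Matrix.mul_apply]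
  refine Finset.sum_congr rfl fun b _ => ?_
  rw [h1, Matrix.mul_apply, Matrix.conjTranspose_apply]
  rfl

theorem isCPTP_krausMap [DecidableEq ι] {A : α → Matrix ι ι ℂ} (hA : ∑ i, (A i)ᴴ * A i = 1) :
    IsCPTP (krausMap A) := by
  refine ⟨fun m X hX => ?_, trace_krausMap hA⟩
  rw [tensorId_krausMap]
  exact krausMap_posSemidef _ hX

theorem extendMap_krausMap {n : ℕ} {d : Fin n → ℕ} (S : Finset (Fin n))
    (A : α → Matrix (InConfig d S) (InConfig d S) ℂ) :
    extendMap S (krausMap A) = krausMap fun i => extendOp S (A i) := by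
  refine LinearMap.ext fun X => ?_
  simp only [extendMap, tensorId_krausMap, LinearMap.comp_apply, krausMap_apply,
    LinearEquiv.coe_coe, map_sum]
  refine Finset.sum_congr rfl fun i _ => ?_
  simp [extendOp, Matrix.conjTranspose_submatrix,
    ← Matrix.submatrix_mul_equiv _ _ _ (splitConfig d S) _]

theorem sum_single_one [DecidableEq ι] : ∑ j : ι, Matrix.single j j (1 : ℂ) = 1 := by
  ext a b
  simp [Matrix.sum_apply, Matrix.single_apply, Matrix.one_apply, ite_and]

/-- Kraus operators of the channel that measures the projection `Q` and prepares the completely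
mixed state if the outcome is `1`. -/
noncomputable def resetKraus [DecidableEq ι] (Q : Matrix ι ι ℂ) : Option (ι × ι) → Matrix ι ι ℂ
  | none => 1 - Q
  | some (i, j) => ((Real.sqrt (Fintype.card ι))⁻¹ : ℂ) • (Matrix.single i j 1 * Q)

theorem sum_resetKraus [DecidableEq ι] [Nonempty ι] {Q : Matrix ι ι ℂ} (hh : Q.IsHermitian)
    (hi : Q * Q = Q) : ∑ x, (resetKraus Q x)ᴴ * resetKraus Q x = 1 := by
  have hc : (Fintype.card ι : ℂ) ≠ 0 := by exact_mod_cast Fintype.card_ne_zero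
  have hs : ((Real.sqrt (Fintype.card ι))⁻¹ : ℂ) * ((Real.sqrt (Fintype.card ι))⁻¹ : ℂ) =
      (Fintype.card ι : ℂ)⁻¹ := by
    rw [← mul_inv]
    rw [← Complex.ofReal_mul, Real.mul_self_sqrt (Nat.cast_nonneg _), Complex.ofReal_natCast]
  have hsome : ∀ i j : ι, (resetKraus Q (some (i, j)))ᴴ * resetKraus Q (some (i, j)) =
      (Fintype.card ι : ℂ)⁻¹ • (Q * Matrix.single j j 1 * Q) := by
    intro i j
    rw [resetKraus, Matrix.conjTranspose_smul, Matrix.smul_mul, Matrix.mul_smul, smul_smul,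
      Matrix.conjTranspose_mul, hh, Matrix.conjTranspose_single]
    have : star ((Real.sqrt (Fintype.card ι))⁻¹ : ℂ) = ((Real.sqrt (Fintype.card ι))⁻¹ : ℂ) := by
      rw [← Complex.ofReal_inv, Complex.star_def, Complex.conj_ofReal]
    rw [this, hs, star_one, ← Matrix.mul_assoc, Matrix.mul_assoc Q, Matrix.single_mul_single_same,
      one_mul]
  rw [Fintype.sum_option, Fintype.sum_prod_type]
  simp only [hsome, ← Finset.smul_sum, ← Matrix.sum_mul, ← Matrix.mul_sum, sum_single_one, Matrix.mul_one,
    hi, Finset.sum_const, Finset.card_univ]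
  rw [resetKraus, Matrix.conjTranspose_sub, Matrix.conjTranspose_one, hh, Matrix.sub_mul,
    Matrix.mul_sub, Matrix.mul_sub, hi, ← Nat.cast_smul_eq_nsmul ℂ, smul_smul,
    inv_mul_cancel₀ hc]
  simp

end Kraus

/-! ### Trace inequalities, fidelity and positive definite matrices -/

section Matrices

variable {ι : Type} [Fintype ι]

theorem trace_mul_nonneg {A B : Matrix ι ι ℂ} (hA : A.PosSemidef) (hB : B.PosSemidef) :
    0 ≤ (A * B).trace := by
  classical
  obtain ⟨C, rfl⟩ : ∃ C : Matrix ι ι ℂ, B = Cᴴ * C := by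
    open MatrixOrder in
    obtain ⟨C, hC⟩ := CStarAlgebra.nonneg_iff_eq_star_mul_self.1 hB.nonneg
    exact ⟨C, hC⟩
  rw [← Matrix.mul_assoc, Matrix.trace_mul_comm, ← Matrix.mul_assoc]
  exact (hA.mul_mul_conjTranspose_same C).trace_nonneg

theorem IsDensity.sum_normSq_le {σ : Matrix ι ι ℂ} (h : IsDensity σ) :
    ∑ i, ∑ j, Complex.normSq (σ i j) ≤ 1 := by
  classical
  have hdiag : ∀ i, σ i i = ((σ i i).re : ℂ) := fun i => (h.1.1.coe_re_apply_self i).symm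
  -- This is nonnegativity of the two-by-two principal minors.
  have hminor : ∀ i j, Complex.normSq (σ i j) ≤ (σ i i).re * (σ j j).re := by
    intro i j
    have h1 := (h.1.submatrix ![i, j]).det_nonneg
    rw [Matrix.det_fin_two] at h1
    simp only [Matrix.submatrix_apply, Matrix.cons_val_zero, Matrix.cons_val_one] at h1
    rw [← h.1.1.apply j i, Complex.star_def, Complex.mul_conj, hdiag i, hdiag j] at h1
    have h2 := (Complex.nonneg_iff.1 h1).1
    simp only [← Complex.ofReal_mul, ← Complex.ofReal_sub, Complex.ofReal_re] at h2
    linarith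
  have htr : ∑ i, (σ i i).re = 1 := by
    have := congrArg Complex.re h.2
    simpa [Matrix.trace] using this
  calc ∑ i, ∑ j, Complex.normSq (σ i j) ≤ ∑ i, ∑ j, (σ i i).re * (σ j j).re :=
        Finset.sum_le_sum fun i _ => Finset.sum_le_sum fun j _ => hminor i j
    _ = (∑ i, (σ i i).re) * ∑ j, (σ j j).re := by rw [Finset.sum_mul_sum]
    _ = 1 := by rw [htr, one_mul]

theorem trace_mul_self_of_isHermitian {X : Matrix ι ι ℂ} (h : X.IsHermitian) :
    (X * X).trace = ((∑ i, ∑ j, Complex.normSq (X i j) : ℝ) : ℂ) := by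
  simp only [Matrix.trace, Matrix.diag_apply, Matrix.mul_apply, Complex.ofReal_sum]
  refine Finset.sum_congr rfl fun i _ => Finset.sum_congr rfl fun j _ => ?_
  rw [← h.apply j i, Complex.star_def, Complex.mul_conj]

theorem pureState_mul_self {ψ : ι → ℂ} (hψ : IsUnitVec ψ) :
    pureState ψ * pureState ψ = pureState ψ := by
  rw [pureState, Matrix.vecMulVec_mul_vecMulVec, hψ, one_smul]

/-- Densities whose fidelity with a pure state tends to one converge to that state. -/
theorem tendsto_pureState {ψ : ι → ℂ} (hψ : IsUnitVec ψ) {σ : ℕ → Matrix ι ι ℂ}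
    (hσ : ∀ k, IsDensity (σ k))
    (h : Tendsto (fun k => (pureState ψ * σ k).trace.re) atTop (𝓝 1)) :
    Tendsto σ atTop (𝓝 (pureState ψ)) := by
  set ρ := pureState ψ with hρ
  -- The squared Frobenius distance is `tr σ² - 2 tr (ρ σ) + 1`, and `tr σ² ≤ 1`.
  have hbound : ∀ k i j, Complex.normSq (σ k i j - ρ i j) ≤ 2 - 2 * (ρ * σ k).trace.re := by
    intro k i j
    have hX : (σ k - ρ).IsHermitian := (hσ k).1.1.sub (pureState_posSemidef ψ).1
    have h1 := trace_mul_self_of_isHermitian hX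
    have h2 := trace_mul_self_of_isHermitian (hσ k).1.1
    have h3 := (hσ k).sum_normSq_le
    have h4 : Complex.normSq ((σ k - ρ) i j) ≤
        ∑ i, ∑ j, Complex.normSq ((σ k - ρ) i j) :=
      (Finset.single_le_sum (f := fun j => Complex.normSq ((σ k - ρ) i j))
        (fun j _ => Complex.normSq_nonneg _) (Finset.mem_univ j)).trans
      (Finset.single_le_sum (f := fun i => ∑ j, Complex.normSq ((σ k - ρ) i j))
        (fun i _ => Finset.sum_nonneg fun j _ => Complex.normSq_nonneg _) (Finset.mem_univ i))
    rw [Matrix.sub_mul, Matrix.mul_sub, Matrix.mul_sub, Matrix.trace_sub, Matrix.trace_sub,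
      Matrix.trace_sub, Matrix.trace_mul_comm (σ k) ρ, h2, hρ, pureState_mul_self hψ,
      (isDensity_pureState hψ).2] at h1
    have h5 := congrArg Complex.re h1
    simp only [Complex.sub_re, Complex.ofReal_re, Complex.one_re] at h5
    rw [Matrix.sub_apply] at h4
    linarith
  have hzero : Tendsto (fun k => 2 - 2 * (ρ * σ k).trace.re) atTop (𝓝 0) := by
    have := (h.const_mul 2).const_sub 2
    simpa using this
  refine tendsto_pi_nhds.2 fun i => tendsto_pi_nhds.2 fun j => ?_
  rw [tendsto_iff_norm_sub_tendsto_zero]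
  have h1 : Tendsto (fun k => Complex.normSq (σ k i j - ρ i j)) atTop (𝓝 0) :=
    squeeze_zero (fun k => Complex.normSq_nonneg _) (fun k => hbound k i j) hzero
  have h2 := h1.sqrt
  rw [Real.sqrt_zero] at h2
  refine h2.congr fun k => ?_
  rw [Complex.normSq_eq_norm_sq, Real.sqrt_sq (norm_nonneg _)]

/-- A positive definite matrix dominates a positive multiple of the identity. -/
theorem exists_pos_smul_one_le [DecidableEq ι] {A : Matrix ι ι ℂ} (hA : A.PosDef) :
    ∃ r : ℝ, 0 < r ∧ (A - (r : ℂ) • 1).PosSemidef := by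
  obtain ⟨r, hr, hle⟩ : ∃ r : ℝ, 0 < r ∧ ∀ i, r ≤ hA.1.eigenvalues i := by
    rcases isEmpty_or_nonempty ι with h | h
    · exact ⟨1, one_pos, fun i => isEmptyElim i⟩
    · obtain ⟨i, hi⟩ := Finite.exists_min hA.1.eigenvalues
      exact ⟨_, hA.eigenvalues_pos i, hi⟩
  refine ⟨r, hr, ?_⟩
  set U : Matrix ι ι ℂ := (hA.1.eigenvectorUnitary).val with hU
  have hUU : U * Uᴴ = 1 := Matrix.mem_unitaryGroup_iff.1 hA.1.eigenvectorUnitary.2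
  have h1 : A = U * Matrix.diagonal (fun i => (hA.1.eigenvalues i : ℂ)) * Uᴴ := by
    have := hA.1.spectral_theorem
    rw [Unitary.conjStarAlgAut_apply] at this
    exact this
  have h2 : A - (r : ℂ) • 1 =
      U * Matrix.diagonal (fun i => ((hA.1.eigenvalues i - r : ℝ) : ℂ)) * Uᴴ := by
    have h3 : Matrix.diagonal (fun i => ((hA.1.eigenvalues i - r : ℝ) : ℂ)) =
        Matrix.diagonal (fun i => (hA.1.eigenvalues i : ℂ)) - (r : ℂ) • 1 := by
      ext i j
      by_cases h : i = j
      · subst h; simp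
      · simp [h]
    rw [h3, Matrix.mul_sub, Matrix.sub_mul, ← h1, Matrix.mul_smul, Matrix.mul_one,
      Matrix.smul_mul, hUU]
  rw [h2]
  refine Matrix.PosSemidef.mul_mul_conjTranspose_same (Matrix.PosSemidef.diagonal fun i => ?_) U
  exact Complex.zero_le_real.2 (sub_nonneg.2 (hle i))

/-- Compression of `A` to the complement of a unit eigenvector. -/
theorem compress_eq [DecidableEq ι] {A : Matrix ι ι ℂ} (hA : A.IsHermitian) {ψ : ι → ℂ}
    (hψ : IsUnitVec ψ) (h : A *ᵥ ψ = ψ) :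
    (1 - pureState ψ)ᴴ * A * (1 - pureState ψ) = A - pureState ψ := by
  have h1 : A * pureState ψ = pureState ψ := by
    rw [pureState, Matrix.mul_vecMulVec, h]
  have h2 : pureState ψ * A = pureState ψ := by
    have := congrArg Matrix.conjTranspose h1
    rwa [Matrix.conjTranspose_mul, hA, (pureState_posSemidef ψ).1] at this
  rw [Matrix.conjTranspose_sub, Matrix.conjTranspose_one, (pureState_posSemidef ψ).1,
    Matrix.sub_mul, one_mul, h2, Matrix.mul_sub, mul_one, Matrix.sub_mul, h1,
    pureState_mul_self hψ, sub_self, sub_zero]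

end Matrices

/-! ### Propagators and cyclic schedules -/

section Propagators

variable {ι : Type}

theorem propagator_add (E : ℕ → SuperOp ι) (s a b : ℕ) :
    propagator E s (a + b) = propagator E (s + a) b ∘ₗ propagator E s a := by
  induction b with
  | zero => rfl
  | succ b ih =>
    rw [← Nat.add_assoc, propagator, propagator, ih, Nat.add_assoc, LinearMap.comp_assoc]

/-- The observables obtained from `A` by evolving backwards with the maps `D`, from time `s + k`
to time `s`. -/
def backward (D : ℕ → SuperOp ι) (A : Matrix ι ι ℂ) (s : ℕ) : ℕ → Matrix ι ι ℂ
  | 0 => A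
  | k + 1 => D s (backward D A (s + 1) k)

theorem backward_congr {D : ℕ → SuperOp ι} (A : Matrix ι ι ℂ) {s s' : ℕ}
    (h : ∀ t, D (s + t) = D (s' + t)) (k : ℕ) : backward D A s k = backward D A s' k := by
  induction k generalizing s s' with
  | zero => rfl
  | succ k ih =>
    have h1 : ∀ t, D (s + 1 + t) = D (s' + 1 + t) := fun t => by
      rw [Nat.add_assoc, Nat.add_assoc]
      exact h (1 + t)
    rw [backward, backward, ih h1, show D s = D s' from h 0]

/-- The cyclic enumeration of `Fin K`. -/
def cyclic {K : ℕ} (hK : 0 < K) (t : ℕ) : Fin K := ⟨t % K, Nat.mod_lt t hK⟩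

theorem cyclic_add {K : ℕ} (hK : 0 < K) (s t m : ℕ) :
    cyclic hK (s + K * m + t) = cyclic hK (s + t) := by
  refine Fin.ext ?_
  have : s + K * m + t = s + t + K * m := by ring
  simp [cyclic, this]

theorem cyclic_val {K : ℕ} (hK : 0 < K) (j : Fin K) : cyclic hK j = j :=
  Fin.ext (Nat.mod_eq_of_lt j.2)

end Propagators

/-! ### Convergence under cyclic application of an attracting family -/

section Convergence

variable {ι : Type} [Fintype ι] {K : ℕ} {α : Fin K → Type} [∀ j, Fintype (α j)]

variable {B : ∀ j, α j → Matrix ι ι ℂ} {ψ : ι → ℂ}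

/-- The dual (Heisenberg picture) of the channel with Kraus operators `A i`. -/
def dualKrausMap {β : Type} [Fintype β] (A : β → Matrix ι ι ℂ) : SuperOp ι :=
  krausMap fun i => (A i)ᴴ

theorem dualKrausMap_apply {β : Type} [Fintype β] (A : β → Matrix ι ι ℂ) (X : Matrix ι ι ℂ) :
    dualKrausMap A X = ∑ i, (A i)ᴴ * X * A i := by
  simp [dualKrausMap, krausMap_apply]

/-- The observable `|ψ⟩⟨ψ|` at time `s + k`, evolved back to time `s` under the cyclic
application of the channels. -/
def observable (B : ∀ j, α j → Matrix ι ι ℂ) (ψ : ι → ℂ) (hK : 0 < K) (s k : ℕ) :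
    Matrix ι ι ℂ :=
  backward (fun t => dualKrausMap (B (cyclic hK t))) (pureState ψ) s k

theorem observable_succ (hK : 0 < K) (s k : ℕ) : observable B ψ hK s (k + 1) =
    dualKrausMap (B (cyclic hK s)) (observable B ψ hK (s + 1) k) := rfl

theorem observable_periodic (hK : 0 < K) (s m k : ℕ) :
    observable B ψ hK (s + K * m) k = observable B ψ hK s k :=
  backward_congr _ (fun t => by rw [cyclic_add]) k

theorem observable_posSemidef (hK : 0 < K) (s k : ℕ) :
    (observable B ψ hK s k).PosSemidef := by
  induction k generalizing s with
  | zero => exact pureState_posSemidef ψ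
  | succ k ih => exact krausMap_posSemidef _ (ih (s + 1))

theorem trace_observable_mul (hK : 0 < K) (s k : ℕ) (X : Matrix ι ι ℂ) :
    (observable B ψ hK s k * X).trace =
      (pureState ψ * propagator (fun t => krausMap (B (cyclic hK t))) s k X).trace := by
  induction k generalizing s X with
  | zero => rfl
  | succ k ih =>
    -- `observable` unfolds at the first time step but `propagator` at the last, hence the splitting
    -- as `1 + k`.
    rw [observable_succ, dualKrausMap, ← trace_mul_krausMap, ih, Nat.add_comm k 1,
      propagator_add]
    rfl

/-- The vectors annihilated by the observable. -/
def kernel (B : ∀ j, α j → Matrix ι ι ℂ) (ψ : ι → ℂ) (hK : 0 < K) (s k : ℕ) :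
    Submodule ℂ (ι → ℂ) :=
  LinearMap.ker (observable B ψ hK s k).mulVecLin

theorem mem_kernel (hK : 0 < K) (s k : ℕ) (φ : ι → ℂ) :
    φ ∈ kernel B ψ hK s k ↔ observable B ψ hK s k *ᵥ φ = 0 := by
  rw [kernel, LinearMap.mem_ker, Matrix.mulVecLin_apply]

/-- The expectation of the evolved observable at `φ` is the sum of the nonnegative expectations at
the vectors `B i φ`, so each of them vanishes. -/
theorem mulVec_mem_kernel (hK : 0 < K) {s k : ℕ} {φ : ι → ℂ}
    (hφ : φ ∈ kernel B ψ hK s (k + 1)) (i : α (cyclic hK s)) :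
    B (cyclic hK s) i *ᵥ φ ∈ kernel B ψ hK (s + 1) k := by
  have hps := observable_posSemidef (B := B) (ψ := ψ) hK (s + 1) k
  rw [mem_kernel, ← hps.dotProduct_mulVec_zero_iff]
  rw [mem_kernel, observable_succ, dualKrausMap_apply] at hφ
  have h1 : ∑ i, star (B (cyclic hK s) i *ᵥ φ) ⬝ᵥ
      (observable B ψ hK (s + 1) k *ᵥ (B (cyclic hK s) i *ᵥ φ)) = 0 := by
    have h2 := congrArg (fun v => star φ ⬝ᵥ v) hφ
    simp only [Matrix.sum_mulVec, dotProduct_sum, dotProduct_zero] at h2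
    rw [← h2]
    refine Finset.sum_congr rfl fun i _ => ?_
    rw [Matrix.star_mulVec, ← Matrix.dotProduct_mulVec, Matrix.mulVec_mulVec,
      Matrix.mulVec_mulVec, Matrix.mul_assoc]
  exact (Finset.sum_eq_zero_iff_of_nonneg fun i _ => hps.dotProduct_mulVec_nonneg _).1 h1 i
    (Finset.mem_univ i)

variable [DecidableEq ι]

/-- A finite family of channels in Kraus form with common eigenvector `ψ` of all Kraus
operators, such that no nonzero subspace orthogonal to `ψ` is invariant under all of them, and such
that a vector lies in every subspace that contains its images under the Kraus operators of one of
the channels. -/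
structure IsAttractingFamily (B : ∀ j, α j → Matrix ι ι ℂ) (ψ : ι → ℂ) : Prop where
  unit : IsUnitVec ψ
  sum_eq : ∀ j, ∑ i, (B j i)ᴴ * B j i = 1
  eigen : ∀ j i, ∃ r : ℂ, B j i *ᵥ ψ = r • ψ
  mem_of_forall : ∀ (S : Submodule ℂ (ι → ℂ)) j φ, (∀ i, B j i *ᵥ φ ∈ S) → φ ∈ S
  eq_bot : ∀ S : Submodule ℂ (ι → ℂ), (∀ j i, ∀ φ ∈ S, B j i *ᵥ φ ∈ S) →
    (∀ φ ∈ S, star ψ ⬝ᵥ φ = 0) → S = ⊥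

namespace IsAttractingFamily

theorem dual_mulVec (hB : IsAttractingFamily B ψ) (j : Fin K) {A : Matrix ι ι ℂ}
    (hA : A *ᵥ ψ = ψ) : dualKrausMap (B j) A *ᵥ ψ = ψ := by
  have h1 : ∀ i, ((B j i)ᴴ * A * B j i) *ᵥ ψ = ((B j i)ᴴ * B j i) *ᵥ ψ := by
    intro i
    obtain ⟨r, hr⟩ := hB.eigen j i
    rw [← Matrix.mulVec_mulVec, ← Matrix.mulVec_mulVec, ← Matrix.mulVec_mulVec, hr,
      Matrix.mulVec_smul A, hA]
  rw [dualKrausMap_apply, Matrix.sum_mulVec, Finset.sum_congr rfl fun i _ => h1 i,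
    ← Matrix.sum_mulVec, hB.sum_eq, Matrix.one_mulVec]

theorem krausMap_pureState (hB : IsAttractingFamily B ψ) (j : Fin K) :
    krausMap (B j) (pureState ψ) = pureState ψ := by
  have h1 : ∀ i, B j i * pureState ψ * (B j i)ᴴ =
      (star ψ ⬝ᵥ (((B j i)ᴴ * B j i) *ᵥ ψ)) • pureState ψ := by
    intro i
    obtain ⟨r, hr⟩ := hB.eigen j i
    rw [mul_pureState_mul, ← Matrix.mulVec_mulVec, Matrix.dotProduct_mulVec, ← Matrix.star_mulVec,
      hr, star_smul, smul_dotProduct, dotProduct_smul, hB.unit, pureState, pureState, star_smul,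
      Matrix.smul_vecMulVec, Matrix.vecMulVec_smul, smul_smul]
    simp [mul_comm]
  rw [krausMap_apply, Finset.sum_congr rfl fun i _ => h1 i, ← Finset.sum_smul, ← dotProduct_sum,
    ← Matrix.sum_mulVec, hB.sum_eq, Matrix.one_mulVec, hB.unit, one_smul]

/-- The evolved projection is positive and fixes `ψ`, so subtracting `|ψ⟩⟨ψ|` leaves its compression
to the complement of `ψ`. -/
theorem dual_sub_posSemidef (hB : IsAttractingFamily B ψ) (j : Fin K) :
    (dualKrausMap (B j) (pureState ψ) - pureState ψ).PosSemidef := by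
  have h1 : (dualKrausMap (B j) (pureState ψ)).PosSemidef :=
    krausMap_posSemidef _ (pureState_posSemidef ψ)
  have h2 : dualKrausMap (B j) (pureState ψ) *ᵥ ψ = ψ :=
    hB.dual_mulVec j (by rw [pureState_mulVec, hB.unit, one_smul])
  rw [← compress_eq h1.1 hB.unit h2]
  exact h1.conjTranspose_mul_mul_same _

theorem observable_mulVec (hB : IsAttractingFamily B ψ) (hK : 0 < K) (s k : ℕ) :
    observable B ψ hK s k *ᵥ ψ = ψ := by
  induction k generalizing s with
  | zero => rw [observable, backward, pureState_mulVec, hB.unit, one_smul]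
  | succ k ih => exact hB.dual_mulVec _ (ih (s + 1))

theorem observable_mono (hB : IsAttractingFamily B ψ) (hK : 0 < K) (s k : ℕ) :
    (observable B ψ hK s (k + 1) - observable B ψ hK s k).PosSemidef := by
  induction k generalizing s with
  | zero => exact hB.dual_sub_posSemidef _
  | succ k ih =>
    rw [observable_succ hK s (k + 1), observable_succ hK s k, ← map_sub]
    exact krausMap_posSemidef _ (ih (s + 1))

theorem kernel_antitone (hB : IsAttractingFamily B ψ) (hK : 0 < K) (s : ℕ) :
    Antitone (kernel B ψ hK s) := by
  refine antitone_nat_of_succ_le fun k φ hφ => ?_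
  rw [mem_kernel] at hφ ⊢
  have h1 := (hB.observable_mono hK s k).dotProduct_mulVec_nonneg φ
  rw [Matrix.sub_mulVec, hφ, zero_sub, dotProduct_neg] at h1
  have h2 := (observable_posSemidef (B := B) (ψ := ψ) hK s k).dotProduct_mulVec_nonneg φ
  rw [← (observable_posSemidef hK s k).dotProduct_mulVec_zero_iff]
  exact le_antisymm (neg_nonneg.1 h1) h2

/-- Let `S s` be the intersection at starting time `s`. The Kraus operators of step `s` map `S s`
into `S (s + 1)`, so `mem_of_forall` gives `S s ≤ S (s + 1)`. Periodicity turns this increasing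
chain into a constant one, so its value is invariant under every channel. It is orthogonal to `ψ` by
the term `k = 0`, hence trivial. -/
theorem iInf_kernel_eq_bot (hB : IsAttractingFamily B ψ) (hK : 0 < K) (s : ℕ) :
    ⨅ k, kernel B ψ hK s k = ⊥ := by
  set S : ℕ → Submodule ℂ (ι → ℂ) := fun s => ⨅ k, kernel B ψ hK s k with hS
  have hstep : ∀ s φ, φ ∈ S s → ∀ i, B (cyclic hK s) i *ᵥ φ ∈ S (s + 1) := by
    intro s φ hφ i
    rw [hS, Submodule.mem_iInf] at hφ ⊢
    exact fun k => mulVec_mem_kernel hK (hφ (k + 1)) i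
  have hmono : Monotone S := monotone_nat_of_le_succ fun s φ hφ =>
    hB.mem_of_forall _ _ φ (hstep s φ hφ)
  have hconst : ∀ s, S s = S 0 := by
    intro s
    refine le_antisymm ?_ (hmono (Nat.zero_le s))
    have h1 : S (0 + K * s) = S 0 := by simp only [hS, observable_periodic, kernel]
    rw [← h1, Nat.zero_add]
    exact hmono (Nat.le_mul_of_pos_left s hK)
  change S s = ⊥
  rw [hconst s]
  refine hB.eq_bot _ (fun j i φ hφ => ?_) fun φ hφ => ?_
  · rw [← hconst (j + 1)]
    rw [← hconst j] at hφ
    have h2 := hstep j φ hφ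
    rw [cyclic_val] at h2
    exact h2 i
  · have h1 := (Submodule.mem_iInf _).1 hφ 0
    rw [mem_kernel, observable, backward, pureState_mulVec] at h1
    refine (smul_eq_zero.1 h1).resolve_right ?_
    rintro rfl
    simpa [IsUnitVec] using hB.unit

theorem exists_observable_posDef (hB : IsAttractingFamily B ψ) (hK : 0 < K) (s : ℕ) :
    ∃ m, (observable B ψ hK s (K * (m + 1))).PosDef := by
  -- The decreasing kernels stabilize in finite dimension. The time is then enlarged to `K * (m +
  -- 1)`, a positive number of whole cycles, so that blocks of this length all carry the same
  -- observable.
  obtain ⟨m, hm⟩ := IsArtinian.monotone_stabilizes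
    (⟨fun k => OrderDual.toDual (kernel B ψ hK s k), fun a b h => hB.kernel_antitone hK s h⟩ :
      ℕ →o (Submodule ℂ (ι → ℂ))ᵒᵈ)
  have hbot : kernel B ψ hK s m = ⊥ := by
    rw [eq_bot_iff, ← hB.iInf_kernel_eq_bot hK s]
    refine le_iInf fun k => ?_
    rcases le_total m k with h | h
    · have h1 : kernel B ψ hK s m = kernel B ψ hK s k := hm k h
      exact h1.le
    · exact hB.kernel_antitone hK s h
  refine ⟨m, Matrix.PosDef.of_dotProduct_mulVec_pos (observable_posSemidef hK s _).1 fun φ hφ => ?_⟩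
  have hps := observable_posSemidef (B := B) (ψ := ψ) hK s (K * (m + 1))
  refine lt_of_le_of_ne (hps.dotProduct_mulVec_nonneg φ) fun h => hφ ?_
  have h1 := (hps.dotProduct_mulVec_zero_iff φ).1 h.symm
  rw [← mem_kernel] at h1
  have h2 := hB.kernel_antitone hK s
    ((Nat.le_succ m).trans (Nat.le_mul_of_pos_left (m + 1) hK)) h1
  rwa [hbot, Submodule.mem_bot] at h2

theorem propagator_isDensity (hB : IsAttractingFamily B ψ) (hK : 0 < K) {σ : Matrix ι ι ℂ}
    (hσ : IsDensity σ) (s k : ℕ) :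
    IsDensity (propagator (fun t => krausMap (B (cyclic hK t))) s k σ) := by
  induction k with
  | zero => exact hσ
  | succ k ih =>
    rw [propagator, LinearMap.comp_apply]
    exact ⟨krausMap_posSemidef _ ih.1, by rw [trace_krausMap (hB.sum_eq _), ih.2]⟩

theorem tendsto_propagator (hB : IsAttractingFamily B ψ) (hK : 0 < K) {σ : Matrix ι ι ℂ}
    (hσ : IsDensity σ) (s : ℕ) :
    Tendsto (fun k => propagator (fun t => krausMap (B (cyclic hK t))) s k σ) atTop
      (𝓝 (pureState ψ)) := by
  set τ := fun k => propagator (fun t => krausMap (B (cyclic hK t))) s k σ with hτ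
  have hden : ∀ k, IsDensity (τ k) := hB.propagator_isDensity hK hσ s
  refine tendsto_pureState hB.unit hden ?_
  set f : ℕ → ℝ := fun k => (pureState ψ * τ k).trace.re with hf
  have hstep : ∀ k l, f (k + l) = (observable B ψ hK (s + k) l * τ k).trace.re := by
    intro k l
    rw [trace_observable_mul]
    simp only [hf, hτ, propagator_add, LinearMap.comp_apply]
  have hmono : Monotone f := by
    refine monotone_nat_of_le_succ fun k => ?_
    have h1 := (Complex.nonneg_iff.1
      (trace_mul_nonneg (hB.dual_sub_posSemidef (cyclic hK (s + k))) (hden k).1)).1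
    rw [Matrix.sub_mul, Matrix.trace_sub, Complex.sub_re, sub_nonneg] at h1
    exact h1.trans (hstep k 1).ge
  have hle : ∀ k, f k ≤ 1 := by
    intro k
    have h0 := compress_eq Matrix.isHermitian_one hB.unit (Matrix.one_mulVec ψ)
    have h1 : (1 - pureState ψ).PosSemidef := by
      rw [← h0]
      exact Matrix.PosSemidef.one.conjTranspose_mul_mul_same _
    have h2 := (Complex.nonneg_iff.1 (trace_mul_nonneg h1 (hden k).1)).1
    rw [Matrix.sub_mul, one_mul, Matrix.trace_sub, Complex.sub_re, sub_nonneg, (hden k).2] at h2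
    simpa using h2
  obtain ⟨m, hm⟩ := hB.exists_observable_posDef hK s
  obtain ⟨r, hr, hrA⟩ := exists_pos_smul_one_le hm
  set T := K * (m + 1) with hT
  set A := observable B ψ hK s T with hA
  have hAψ : A *ᵥ ψ = ψ := hB.observable_mulVec hK s T
  have hr1 : r ≤ 1 := by
    have h1 := (Complex.nonneg_iff.1 (hrA.dotProduct_mulVec_nonneg ψ)).1
    rw [Matrix.sub_mulVec, hAψ, Matrix.smul_mulVec, Matrix.one_mulVec, dotProduct_sub,
      dotProduct_smul, hB.unit] at h1
    simpa using h1
  -- Compressing `A ≥ r` to the complement of `ψ` bounds the gain in fidelity over `T` steps below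
  -- by `r` times the current infidelity.
  have hcomp : (A - pureState ψ - (r : ℂ) • (1 - pureState ψ)).PosSemidef := by
    have h1 := hrA.conjTranspose_mul_mul_same (1 - pureState ψ)
    rw [Matrix.mul_sub _ A, Matrix.sub_mul, compress_eq hm.1 hB.unit hAψ, Matrix.mul_smul,
      Matrix.smul_mul, compress_eq Matrix.isHermitian_one hB.unit (Matrix.one_mulVec ψ)] at h1
    exact h1
  have hcontr : ∀ j, 1 - f (T * (j + 1)) ≤ (1 - r) * (1 - f (T * j)) := by
    intro j
    have h1 := (Complex.nonneg_iff.1 (trace_mul_nonneg hcomp (hden (T * j)).1)).1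
    have h2 : observable B ψ hK (s + T * j) T = A := by
      rw [hT, Nat.mul_assoc, observable_periodic]
    have h3 := hstep (T * j) T
    rw [h2] at h3
    rw [Matrix.sub_mul, Matrix.sub_mul, Matrix.smul_mul, Matrix.sub_mul, one_mul,
      Matrix.trace_sub, Matrix.trace_sub, Matrix.trace_smul, Matrix.trace_sub, (hden _).2,
      smul_eq_mul, Complex.sub_re, Complex.sub_re, Complex.re_ofReal_mul, Complex.sub_re,
      Complex.one_re, ← h3] at h1
    change 0 ≤ f (T * j + T) - f (T * j) - r * (1 - f (T * j)) at h1
    rw [Nat.mul_succ]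
    linarith
  have hgeom : ∀ j, 1 - f (T * j) ≤ (1 - r) ^ j * (1 - f 0) := by
    intro j
    induction j with
    | zero => simp
    | succ j ih =>
      refine (hcontr j).trans ?_
      rw [pow_succ', mul_assoc (1 - r)]
      exact mul_le_mul_of_nonneg_left ih (sub_nonneg.2 hr1)
  have hsub : Tendsto (fun j => f (T * j)) atTop (𝓝 1) := by
    have h1 : Tendsto (fun j => (1 - r) ^ j * (1 - f 0)) atTop (𝓝 0) := by
      simpa using (tendsto_pow_atTop_nhds_zero_of_lt_one (sub_nonneg.2 hr1)
        (by linarith : 1 - r < 1)).mul_const (1 - f 0)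
    have h2 : Tendsto (fun j => 1 - f (T * j)) atTop (𝓝 0) :=
      squeeze_zero (fun j => sub_nonneg.2 (hle _)) hgeom h1
    simpa using h2.const_sub 1
  have hTpos : 0 < T := Nat.mul_pos hK (Nat.succ_pos m)
  -- Monotonicity extends the limit from multiples of `T` to all times.
  exact (tendsto_iff_tendsto_subseq_of_monotone hmono
    (tendsto_id.const_mul_atTop' hTpos)).2 hsub

end IsAttractingFamily
end Convergence

/-! ### Stabilization by cyclic resets -/

section MainTheorem

variable {n K : ℕ} {d : Fin n → ℕ}

theorem IsLocallyDetermined.isQLS {N : Fin K → Finset (Fin n)} (hK : 0 < K) {ψ : Config d → ℂ}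
    (hψ : IsUnitVec ψ) (hd : IsLocallyDetermined N ψ) : IsQLS N (pureState ψ) := by
  choose Q hQh hQi hQ using fun k => exists_support_projection (N k) ψ
  have hne : Nonempty (Config d) := by
    by_contra h
    rw [not_nonempty_iff] at h
    simp [IsUnitVec, dotProduct] at hψ
  have hne' : ∀ k, Nonempty (InConfig d (N k)) := fun k => hne.map (labels (N k))
  have hc : ∀ k, ((Real.sqrt (Fintype.card (InConfig d (N k))))⁻¹ : ℂ) ≠ 0 := by
    intro k
    refine inv_ne_zero (Complex.ofReal_ne_zero.2 (Real.sqrt_ne_zero'.2 ?_))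
    exact_mod_cast Fintype.card_pos
  set B : ∀ k, Option (InConfig d (N k) × InConfig d (N k)) → Matrix (Config d) (Config d) ℂ :=
    fun k x => extendOp (N k) (resetKraus (Q k) x) with hBdef
  have hQψ : ∀ k, extendOp (N k) (Q k) *ᵥ ψ = 0 := fun k => (hQ k ψ).2 ⟨1, by simp [outOp]⟩
  have hnone : ∀ k φ, B k none *ᵥ φ = φ - extendOp (N k) (Q k) *ᵥ φ := by
    intro k φ
    have h1 : B k none + extendOp (N k) (Q k) = 1 := by
      simp only [hBdef, resetKraus]
      rw [← extendOp_add, sub_add_cancel, extendOp_one]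
    rw [eq_sub_iff_add_eq, ← Matrix.add_mulVec, h1, Matrix.one_mulVec]
  have hsome : ∀ k i j, B k (some (i, j)) =
      ((Real.sqrt (Fintype.card (InConfig d (N k))))⁻¹ : ℂ) •
        extendOp (N k) (Matrix.single i j 1 * Q k) := fun k i j => extendOp_smul _ _ _
  have hreset : ∀ (S : Submodule ℂ (Config d → ℂ)) k φ i j, B k (some (i, j)) *ᵥ φ ∈ S →
      extendOp (N k) (Matrix.single i j 1 * Q k) *ᵥ φ ∈ S := by
    intro S k φ i j h
    rw [hsome, Matrix.smul_mulVec] at h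
    exact (S.smul_mem_iff (hc k)).1 h
  have hB : IsAttractingFamily B ψ := by
    refine ⟨hψ, fun k => ?_, fun k x => ?_, fun S k φ h => ?_, fun S hinv horth => ?_⟩
    · simp only [hBdef, extendOp_conjTranspose, ← extendOp_mul, ← extendOp_sum]
      rw [sum_resetKraus (hQh k) (hQi k), extendOp_one]
    · rcases x with _ | ⟨i, j⟩
      · exact ⟨1, by rw [hnone, hQψ, sub_zero, one_smul]⟩
      · refine ⟨0, ?_⟩
        rw [hsome, Matrix.smul_mulVec, extendOp_mul, ← Matrix.mulVec_mulVec, hQψ,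
          Matrix.mulVec_zero, smul_zero, zero_smul]
    -- The diagonal resets `|i⟩⟨i| Q` sum to `Q`, and the remaining Kraus operator supplies `(1 - Q)
    -- φ`; together they recover `φ`.
    · have h1 : extendOp (N k) (Q k) *ᵥ φ ∈ S := by
        have h2 : ∑ i, Matrix.single i i (1 : ℂ) * Q k = Q k := by
          rw [← Matrix.sum_mul, sum_single_one, one_mul]
        rw [← h2, extendOp_sum, Matrix.sum_mulVec]
        exact S.sum_mem fun i _ => hreset S k φ i i (h _)
      have h3 := h none
      rw [hnone] at h3
      exact (S.sub_mem_iff_left h1).1 h3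
    · exact hd.eq_bot_of_invariant hψ hQ S
        (fun k i j φ hφ => hreset S k φ i j (hinv k _ φ hφ)) horth
  refine ⟨fun t => krausMap (B (cyclic hK t)), fun t => ⟨cyclic hK t,
    krausMap (resetKraus (Q (cyclic hK t))),
    isCPTP_krausMap (sum_resetKraus (hQh _) (hQi _)), (extendMap_krausMap _ _).symm⟩,
    fun s k => ?_, fun σ hσ s => hB.tendsto_propagator hK hσ s⟩
  induction k with
  | zero => rfl
  | succ k ih => rw [propagator, LinearMap.comp_apply, ih, hB.krausMap_pureState]

end MainTheorem

end QuasiLocal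

theorem mainTheorem7 (n K : ℕ) (d : Fin n → ℕ) (N : Fin K → Finset (Fin n))
    (hK : 0 < K) (hN : ∀ j, N j ⊂ Finset.univ)
    (ψ : QuasiLocal.Config d → ℂ) (hψ : QuasiLocal.IsUnitVec ψ) :
    QuasiLocal.IsQLS N (QuasiLocal.pureState ψ) ↔
      ∃ h : Fin K → Matrix (QuasiLocal.Config d) (QuasiLocal.Config d) ℂ,
        QuasiLocal.IsQuasiLocalHamiltonian N h ∧
        QuasiLocal.IsFrustrationFree h ∧
        QuasiLocal.IsUniqueGroundState (∑ k, h k) ψ :=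
  ⟨fun h => h.isLocallyDetermined.exists_hamiltonian hψ, fun ⟨_, hq, hf, hu⟩ =>
    (QuasiLocal.isLocallyDetermined_of_hamiltonian hq hf hu).isQLS hK hψ⟩
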